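/- Let $(\Omega,\Sigma,\mu)$ be a complete probability space, let $X$ be a real Banach space with dual $X^*$, bidual $X^{**}$ and closed dual unit ball $B_{X^*}=\{x^*\in X^*:\|x^*\|\le 1\}$, let $1\le p<\infty$, and let $1<p'\le\infty$ be the conjugate exponent, $\frac1p+\frac1{p'}=1$. For $f:\Omega\to X$ and $x^*\in X^*$ write $\langle f,x^*\rangle$ for the function $\omega\mapsto x^*(f(\omega))$. Suppose that $f:\Omega\to X$ is strongly measurable (there is a sequence of simple functions $f_n:\Omega\to X$ with $\|f_n(\omega)-f(\omega)\|\to 0$ for $\mu$-a.e. $\omega$) and $p$-Dunford integrable ($\langle f,x^*\rangle\in L^p(\mu)$ for every $x^*\in X^*$). Then $S_f^p:X^*\to L^p(\mu)$, $S_f^p(x^*):=\langle f,x^*\rangle$, is a continuous linear operator; let $T_f^p:L^{p'}(\mu)\to X^{**}$ be its adjoint, under the identification of $L^p(\mu)^*$ with $L^{p'}(\mu)$, i.e. $\langle T_f^p(g),x^*\rangle=\int_\Omega g\,\langle f,x^*\rangle\,d\mu$ for all $g\in L^{p'}(\mu)$ and $x^*\in X^*$. The following statements are equivalent: (i) $T_f^p$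 is a compact operator; (ii) the set $Z_f^p:=\{|\langle f,x^*\rangle|^p : x^*\in B_{X^*}\}$ is uniformly integrable in $L^1(\mu)$, i.e. it is bounded in $L^1(\mu)$ and for every $\epsilon>0$ there is $\delta>0$ such that $\sup_{h\in Z_f^p}\int_A|h|\,d\mu\le\epsilon$ for every $A\in\Sigma$ with $\mu(A)\le\delta$. -/

import Mathlib

open MeasureTheory Filter Topology
open scoped ENNReal

noncomputable section

variable {Ω X : Type*} [MeasurableSpace Ω] [NormedAddCommGroup X] [NormedSpace ℝ X]

/-- `f : Ω → X` is `p`-Dunford integrable with respect to `μ`: the scalar function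
`⟨f, x*⟩ : ω ↦ x* (f ω)` belongs to `L^p(μ)` for every `x*` in the topological dual of `X`.
No measurability of `f` itself is required. -/
def PDunfordIntegrable (p : ℝ≥0∞) (f : Ω → X) (μ : Measure Ω) : Prop :=
  ∀ x' : StrongDual ℝ X, MemLp (fun ω => x' (f ω)) p μ

/-- The linear map `x* ↦ ⟨f, x*⟩` from `X*` to `L^p(μ)`. -/
def dunfordLinear {p : ℝ≥0∞} {f : Ω → X} {μ : Measure Ω} (hf : PDunfordIntegrable p f μ) :
    StrongDual ℝ X →ₗ[ℝ] Lp ℝ p μ where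
  toFun x' := (hf x').toLp (fun ω => x' (f ω))
  map_add' x' y' := (hf x').toLp_add (hf y')
  map_smul' c x' := (hf x').toLp_const_smul c

/-- The map `x* ↦ ⟨f, x*⟩` has closed graph. -/
theorem dunfordLinear_closed_graph {p : ℝ≥0∞} [Fact (1 ≤ p)] {f : Ω → X} {μ : Measure Ω}
    (hf : PDunfordIntegrable p f μ) (u : ℕ → StrongDual ℝ X) (x' : StrongDual ℝ X) (h : Lp ℝ p μ)
    (hu : Tendsto u atTop (𝓝 x')) (hh : Tendsto (dunfordLinear hf ∘ u) atTop (𝓝 h)) :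
    h = dunfordLinear hf x' := by
  obtain ⟨ns, hns, hae⟩ := (tendstoInMeasure_of_tendsto_Lp hh).exists_seq_tendsto_ae
  have h1 : ∀ᵐ ω ∂μ, ∀ n, (dunfordLinear hf (u n) : Ω → ℝ) ω = u n (f ω) :=
    ae_all_iff.2 fun n => (hf (u n)).coeFn_toLp
  have h2 : ∀ᵐ ω ∂μ, (dunfordLinear hf x' : Ω → ℝ) ω = x' (f ω) := (hf x').coeFn_toLp
  apply Lp.ext
  filter_upwards [hae, h1, h2] with ω hω hω1 hω2
  rw [hω2]
  refine tendsto_nhds_unique hω ?_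
  have h3 : Tendsto (fun n => u n (f ω)) atTop (𝓝 (x' (f ω))) :=
    ((ContinuousLinearMap.apply ℝ ℝ (f ω)).continuous.tendsto x').comp hu
  simpa [Function.comp_def, hω1] using h3.comp hns.tendsto_atTop

/-- The operator `S_f^p : X* → L^p(μ)`, `S_f^p x* = ⟨f, x*⟩`, of a `p`-Dunford integrable
function; it is continuous by the closed graph theorem. -/
def dunfordS {p : ℝ≥0∞} [Fact (1 ≤ p)] {f : Ω → X} {μ : Measure Ω}
    (hf : PDunfordIntegrable p f μ) : StrongDual ℝ X →L[ℝ] Lp ℝ p μ :=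
  ContinuousLinearMap.ofSeqClosedGraph (g := dunfordLinear hf) (dunfordLinear_closed_graph hf)

/-- The Dunford operator `T_f^p : L^{p'}(μ) → X**` of a `p`-Dunford integrable function, where
`p'` is the exponent conjugate to `p`. It is the adjoint `φ ↦ φ ∘ S_f^p` of `S_f^p`, viewed on
`L^{p'}(μ)` through the canonical map `L^{p'}(μ) → L^p(μ)*`, `g ↦ (h ↦ ∫ g h dμ)`
(for `1 ≤ p < ∞` and finite `μ`, this is the usual identification of `L^p(μ)*` with
`L^{p'}(μ)`). -/
def dunfordT {p p' : ℝ≥0∞} [Fact (1 ≤ p)] [Fact (1 ≤ p')] [ENNReal.HolderConjugate p p']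
    {f : Ω → X} {μ : Measure Ω} (hf : PDunfordIntegrable p f μ) :
    Lp ℝ p' μ →L[ℝ] StrongDual ℝ (StrongDual ℝ X) :=
  (ContinuousLinearMap.compL ℝ (StrongDual ℝ X) (Lp ℝ p μ) ℝ).flip (dunfordS hf) ∘L
    (ContinuousLinearMap.mul ℝ ℝ).lpPairing μ p' p

/-- The Dunford operator satisfies `⟨T_f^p g, x*⟩ = ∫ g ⟨f, x*⟩ dμ`. -/
theorem dunfordT_apply {p p' : ℝ≥0∞} [Fact (1 ≤ p)] [Fact (1 ≤ p')]
    [ENNReal.HolderConjugate p p'] {f : Ω → X} {μ : Measure Ω} (hf : PDunfordIntegrable p f μ)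
    (g : Lp ℝ p' μ) (x' : StrongDual ℝ X) :
    dunfordT hf g x' = ∫ ω, g ω * x' (f ω) ∂μ := by
  have h1 : dunfordT hf g x' =
      (ContinuousLinearMap.mul ℝ ℝ).lpPairing μ p' p g (dunfordLinear hf x') := rfl
  rw [h1, ContinuousLinearMap.lpPairing_eq_integral]
  refine integral_congr_ae ?_
  have h2 : ∀ᵐ ω ∂μ, (dunfordLinear hf x' : Ω → ℝ) ω = x' (f ω) := (hf x').coeFn_toLp
  filter_upwards [h2] with ω hω
  simp [hω]

/-- The set `Z_f^p = {|⟨f, x*⟩|^p : x* ∈ B_{X*}}` of real functions on `Ω`, where `B_{X*}` is the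
closed unit ball of the dual of `X`. -/
def dunfordZ (p : ℝ≥0∞) (f : Ω → X) : Set (Ω → ℝ) :=
  {h | ∃ x' : StrongDual ℝ X, ‖x'‖ ≤ 1 ∧ h = fun ω => |x' (f ω)| ^ p.toReal}

end

/-! Both conditions are compared with `p`-uniform integrability of the functions `⟨f, x*⟩`, `‖x*‖ ≤
1`. If it holds, discarding `f` where its norm is large changes `S_f` little in operator norm. The
remaining bounded part is an `L^p` limit of simple functions, whose Dunford operators have finite
rank. As `T` depends continuously on `S` and compact operators form a closed set, `T_f` is compact.
If it fails, some `⟨f, x_n⟩` keep `L^p` mass above `ε` on sets `A_n` with `μ A_n → 0`. Reverse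
Hölder gives `g_n` in the unit ball of `L^{p'}`, supported in `A_n`, with `‖T_f g_n‖ ≥ ε`. Yet `T_f
g_n → 0` weak*, so no subsequence converges in norm. -/

set_option maxSynthPendingDepth 3

/-- Reverse Hölder inequality: the `L^p` norm of a real function is attained against a function in
the unit ball of `L^{p'}` that vanishes wherever the given function does. -/
theorem MeasureTheory.MemLp.exists_norming_dual {Ω : Type*} [MeasurableSpace Ω] {μ : Measure Ω}
    {p p' : ℝ≥0∞} [ENNReal.HolderConjugate p p'] (hp : p ≠ ∞) {k : Ω → ℝ} (hk : MemLp k p μ) :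
    ∃ g : Ω → ℝ, MemLp g p' μ ∧ eLpNorm g p' μ ≤ 1 ∧ (∀ ω, k ω = 0 → g ω = 0) ∧
      ∫ ω, g ω * k ω ∂μ = (eLpNorm k p μ).toReal := by
  have hp1 : 1 ≤ p := ENNReal.HolderConjugate.one_le p p'
  have hp0 : p ≠ 0 := (zero_lt_one.trans_le hp1).ne'
  have hpr : 1 ≤ p.toReal := by
    simpa using ENNReal.toReal_mono hp hp1
  set N := (eLpNorm k p μ).toReal with hN
  have hN0 : 0 ≤ N := ENNReal.toReal_nonneg
  rcases hN0.eq_or_lt with hz | hNpos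
  · exact ⟨0, MemLp.zero, by simp, by simp, by simpa using hz⟩
  have heN : eLpNorm k p μ = ENNReal.ofReal N := (ENNReal.ofReal_toReal hk.2.ne).symm
  -- This is `sgn k · |k|^(p-1)`. The factor `k` forces zeros where `k` vanishes, whatever `0 ^ (p -
  -- 2)` is.
  let g₀ : Ω → ℝ := fun ω => k ω * ‖k ω‖ ^ (p.toReal - 2)
  have hg₀m : AEStronglyMeasurable g₀ μ :=
    (hk.1.aemeasurable.mul (hk.1.norm.aemeasurable.pow_const _)).aestronglyMeasurable
  have hnorm : ∀ ω, k ω ≠ 0 → ‖g₀ ω‖ = ‖k ω‖ ^ (p.toReal - 1) := fun ω hω => by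
    have h0 : 0 < ‖k ω‖ := norm_pos_iff.2 hω
    simp only [g₀, norm_mul, Real.norm_of_nonneg (Real.rpow_nonneg (norm_nonneg (k ω)) _)]
    rw [show p.toReal - 1 = 1 + (p.toReal - 2) by ring, Real.rpow_add h0, Real.rpow_one]
  have hgk : ∀ ω, g₀ ω * k ω = ‖k ω‖ ^ p.toReal := fun ω => by
    by_cases hω : k ω = 0
    · simp [g₀, hω, Real.zero_rpow (by linarith : p.toReal ≠ 0)]
    · have h0 : 0 < ‖k ω‖ := norm_pos_iff.2 hω
      simp only [g₀]
      rw [show p.toReal = 2 + (p.toReal - 2) by ring, Real.rpow_add h0, Real.rpow_two,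
        Real.norm_eq_abs, sq_abs]
      ring_nf
  have hint : ∫ ω, g₀ ω * k ω ∂μ = N ^ p.toReal := by
    simp only [hgk]
    have h := hk.eLpNorm_eq_integral_rpow_norm hp0 hp
    have hI : 0 ≤ ∫ ω, ‖k ω‖ ^ p.toReal ∂μ :=
      integral_nonneg fun ω => Real.rpow_nonneg (norm_nonneg _) _
    rw [hN, h, ENNReal.toReal_ofReal (Real.rpow_nonneg hI _),
      Real.rpow_inv_rpow hI (by linarith)]
  have hg₀norm : eLpNorm g₀ p' μ ≤ ENNReal.ofReal (N ^ (p.toReal - 1)) := by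
    -- For `p = 1` the exponent `p - 1` is `0` and `p' = ∞`. Otherwise `p' (p - 1) = p` turns the
    -- `L^{p'}` norm of `g₀` into a power of `N`.
    rcases hpr.eq_or_lt with h1 | h1
    · have hp1' : p = 1 := by
        rw [← ENNReal.ofReal_toReal hp, ← h1, ENNReal.ofReal_one]
      have hp' : p' = ∞ := (ENNReal.HolderConjugate.eq_top_iff_eq_one p' p).2 hp1'
      rw [← h1, hp']
      refine (eLpNorm_le_of_ae_bound (C := 1) (.of_forall fun ω => ?_)).trans (by simp)
      by_cases hω : k ω = 0
      · simp [g₀, hω]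
      · simp [hnorm ω hω, ← h1]
    · have hq : 0 < p.toReal - 1 := by linarith
      have hpp : p' * ENNReal.ofReal (p.toReal - 1) = p := by
        rw [ENNReal.ofReal_sub _ zero_le_one, ENNReal.ofReal_toReal hp, ENNReal.ofReal_one]
        have h2 := ENNReal.HolderConjugate.sub_one_mul_inv p p' hp
        have hp'0 : p' ≠ 0 := ENNReal.HolderConjugate.ne_zero p' p
        have hp't : p' ≠ ∞ := by
          rw [ENNReal.HolderConjugate.ne_top_iff_ne_one p' p]
          rintro rfl
          simp at h1
        calc p' * (p - 1) = p' * ((p - 1) * p⁻¹) * p := by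
              rw [mul_assoc, mul_assoc, ENNReal.inv_mul_cancel hp0 hp, mul_one]
          _ = p := by rw [h2, ENNReal.mul_inv_cancel hp'0 hp't, one_mul]
      have he : eLpNorm g₀ p' μ = eLpNorm (fun ω => ‖k ω‖ ^ (p.toReal - 1)) p' μ := by
        refine eLpNorm_congr_norm_ae (.of_forall fun ω => ?_)
        rw [Real.norm_of_nonneg (Real.rpow_nonneg (norm_nonneg (k ω)) _)]
        by_cases hω : k ω = 0
        · simp [g₀, hω, Real.zero_rpow hq.ne']
        · exact hnorm ω hω
      rw [he, eLpNorm_norm_rpow _ hq, hpp, heN, ENNReal.ofReal_rpow_of_pos hNpos]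
  have hc : 0 < N ^ (p.toReal - 1) := Real.rpow_pos_of_pos hNpos _
  have hbound : eLpNorm ((N ^ (p.toReal - 1))⁻¹ • g₀) p' μ ≤ 1 := by
    rw [eLpNorm_const_smul, Real.enorm_of_nonneg (inv_nonneg.2 hc.le)]
    calc _ ≤ ENNReal.ofReal (N ^ (p.toReal - 1))⁻¹ * ENNReal.ofReal (N ^ (p.toReal - 1)) := by
          gcongr
      _ = 1 := by
          rw [← ENNReal.ofReal_mul (inv_nonneg.2 hc.le), inv_mul_cancel₀ hc.ne', ENNReal.ofReal_one]
  refine ⟨(N ^ (p.toReal - 1))⁻¹ • g₀, ⟨hg₀m.const_smul _, hbound.trans_lt ENNReal.one_lt_top⟩,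
    hbound, fun ω hω => by simp [g₀, hω], ?_⟩
  simp only [Pi.smul_apply, smul_eq_mul, mul_assoc]
  rw [integral_const_mul, hint, Real.rpow_sub_one hNpos.ne']
  field_simp

section Dunford

variable {Ω X : Type*} [MeasurableSpace Ω] [NormedAddCommGroup X] [NormedSpace ℝ X]
  {μ : Measure Ω} {p p' : ℝ≥0∞}

theorem eLpNorm_indicator_abs_rpow (hp0 : p ≠ 0) (hp : p ≠ ∞) (s : Set Ω) (h : Ω → ℝ) :
    eLpNorm (s.indicator fun ω => |h ω| ^ p.toReal) 1 μ =
      eLpNorm (s.indicator h) p μ ^ p.toReal := by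
  have hpr : 0 < p.toReal := ENNReal.toReal_pos hp0 hp
  have he : (s.indicator fun ω => |h ω| ^ p.toReal) =
      fun ω => ‖s.indicator h ω‖ ^ p.toReal := by
    ext ω
    by_cases hω : ω ∈ s <;> simp [hω, Real.zero_rpow hpr.ne']
  rw [he, eLpNorm_norm_rpow _ hpr, one_mul, ENNReal.ofReal_toReal hp]

theorem norm_dunfordS_apply [Fact (1 ≤ p)] {f : Ω → X} (hf : PDunfordIntegrable p f μ)
    (x' : StrongDual ℝ X) :
    ‖dunfordS hf x'‖ = (eLpNorm (fun ω => x' (f ω)) p μ).toReal :=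
  Lp.norm_toLp _ (hf x')

/-- `Z_f^p` is uniformly integrable in `L^1(μ)` iff the functions `⟨f, x*⟩`, `‖x*‖ ≤ 1`, are
`p`-uniformly integrable. -/
theorem uniformIntegrable_dunfordZ_iff [Fact (1 ≤ p)] (hp : p ≠ ∞) {f : Ω → X}
    (hf : PDunfordIntegrable p f μ) :
    UniformIntegrable (fun (h : dunfordZ p f) => (h : Ω → ℝ)) 1 μ ↔
      UnifIntegrable (fun (x' : {x' : StrongDual ℝ X // ‖x'‖ ≤ 1}) ω => x'.1 (f ω)) p μ := by
  have hp0 : p ≠ 0 := (zero_lt_one.trans_le Fact.out).ne'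
  have hpr : 0 < p.toReal := ENNReal.toReal_pos hp0 hp
  constructor
  · rintro ⟨-, hU, -⟩ ε hε
    obtain ⟨δ, hδ, h⟩ := hU (Real.rpow_pos_of_pos hε p.toReal)
    refine ⟨δ, hδ, fun x' s hs hμ => ?_⟩
    have := h ⟨_, x'.1, x'.2, rfl⟩ s hs hμ
    simp only [eLpNorm_indicator_abs_rpow hp0 hp] at this
    rwa [← ENNReal.ofReal_rpow_of_pos hε, ENNReal.rpow_le_rpow_iff hpr] at this
  · intro hU
    -- Boundedness in `L^1` is automatic from continuity of `S_f`.
    refine ⟨?_, fun ε hε => ?_, (‖dunfordS hf‖₊ ^ p.toReal), ?_⟩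
    · rintro ⟨_, x', hx', rfl⟩
      exact ((hf x').1.norm.aemeasurable.pow_const _).aestronglyMeasurable
    · obtain ⟨δ, hδ, h⟩ := hU (Real.rpow_pos_of_pos hε p.toReal⁻¹)
      refine ⟨δ, hδ, ?_⟩
      rintro ⟨_, x', hx', rfl⟩ s hs hμ
      have := h ⟨x', hx'⟩ s hs hμ
      simp only [eLpNorm_indicator_abs_rpow hp0 hp]
      rw [← ENNReal.ofReal_rpow_of_pos hε] at this
      exact (ENNReal.le_rpow_inv_iff hpr).1 this
    · rintro ⟨_, x', hx', rfl⟩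
      have h1 := eLpNorm_indicator_abs_rpow (μ := μ) hp0 hp Set.univ fun ω => x' (f ω)
      simp only [Set.indicator_univ] at h1
      rw [h1, ENNReal.coe_rpow_of_nonneg _ hpr.le]
      refine ENNReal.rpow_le_rpow ?_ hpr.le
      rw [← ENNReal.toReal_le_toReal (hf x').2.ne ENNReal.coe_ne_top, ← norm_dunfordS_apply hf]
      simpa using (dunfordS hf).unit_le_opNorm x' hx'

/-! ### Uniform integrability implies compactness -/

/-- The Dunford operator of a simple function has finite rank, hence is compact. -/
theorem isCompactOperator_dunfordT_simpleFunc [IsFiniteMeasure μ] [Fact (1 ≤ p)] [Fact (1 ≤ p')]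
    [ENNReal.HolderConjugate p p'] (s : SimpleFunc Ω X) (hs : PDunfordIntegrable p s μ) :
    IsCompactOperator (dunfordT (p' := p') hs) := by
  let V : Submodule ℝ (StrongDual ℝ (StrongDual ℝ X)) :=
    Submodule.span ℝ (NormedSpace.inclusionInDoubleDual ℝ X '' s.range)
  have : FiniteDimensional ℝ V :=
    FiniteDimensional.span_of_finite ℝ (s.range.finite_toSet.image _)
  have hV : ∀ g, dunfordT (p' := p') hs g ∈ V := fun g => by
    have hg : Integrable g μ := (Lp.memLp g).integrable Fact.out
    have he : dunfordT (p' := p') hs g =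
        ∑ x ∈ s.range, (∫ ω in s ⁻¹' {x}, g ω ∂μ) • NormedSpace.inclusionInDoubleDual ℝ X x := by
      ext x'
      have h1 : ∀ ω, g ω * x' (s ω) =
          ∑ x ∈ s.range, (s ⁻¹' {x}).indicator g ω * x' x := fun ω => by
        rw [Finset.sum_eq_single (s ω)]
        · simp
        · intro x _ hx
          simp [Set.indicator_of_notMem (show ω ∉ s ⁻¹' {x} from fun h => hx h.symm)]
        · simp
      rw [dunfordT_apply]
      simp only [h1]
      rw [integral_finsetSum _ fun x _ =>
        (hg.indicator (s.measurableSet_fiber x)).mul_const _]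
      simp only [integral_mul_const, integral_indicator (s.measurableSet_fiber _),
        sum_apply, smul_apply, smul_eq_mul,
        NormedSpace.dual_def]
    rw [he]
    exact V.sum_mem fun x hx => V.smul_mem _ (Submodule.subset_span ⟨x, hx, rfl⟩)
  have : ProperSpace V := FiniteDimensional.proper ℝ V
  exact (isCompactOperator_of_locallyCompactSpace_dom
    ((dunfordT (p' := p') hs).codRestrict V hV)).clm_comp V.subtypeL

/-- If the functions `⟨f, x*⟩`, `‖x*‖ ≤ 1`, are `p`-uniformly integrable, then a strongly measurable
`f` is approximated by simple functions in the `p`-Dunford norm. -/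
theorem exists_simpleFunc_norm_dunfordS_sub_le [IsFiniteMeasure μ] [Fact (1 ≤ p)] (hp : p ≠ ∞)
    {f : Ω → X} (hfm : AEStronglyMeasurable f μ) (hf : PDunfordIntegrable p f μ)
    (hU : UnifIntegrable (fun (x' : {x' : StrongDual ℝ X // ‖x'‖ ≤ 1}) ω => x'.1 (f ω)) p μ)
    {ε : ℝ} (hε : 0 < ε) :
    ∃ (s : SimpleFunc Ω X) (hs : PDunfordIntegrable p s μ), ‖dunfordS hf - dunfordS hs‖ ≤ ε := by
  have hp1 : 1 ≤ p := Fact.out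
  obtain ⟨δ, hδ, hUδ⟩ := hU (half_pos hε)
  obtain ⟨g, hg, hfg⟩ := hfm
  have hm : ∀ n : ℕ, MeasurableSet {ω | (n : ℝ) < ‖g ω‖} := fun n =>
    measurableSet_lt measurable_const hg.norm.measurable
  have hlim : Tendsto (fun n : ℕ => μ {ω | (n : ℝ) < ‖g ω‖}) atTop (𝓝 0) := by
    have h := tendsto_measure_iInter_atTop (μ := μ) (s := fun n : ℕ => {ω | (n : ℝ) < ‖g ω‖})
      (fun n => (hm n).nullMeasurableSet)
      (fun m n hmn ω (hω : (n : ℝ) < _) => (Nat.cast_le.2 hmn).trans_lt hω)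
      ⟨0, measure_ne_top _ _⟩
    have hem : ⋂ n : ℕ, {ω | (n : ℝ) < ‖g ω‖} = ∅ := by
      refine Set.eq_empty_of_forall_notMem fun ω hω => ?_
      obtain ⟨n, hn⟩ := exists_nat_ge ‖g ω‖
      exact (Set.mem_iInter.1 hω n).not_ge hn
    rwa [hem, measure_empty] at h
  obtain ⟨n, hn⟩ := (hlim.eventually (ge_mem_nhds (ENNReal.ofReal_pos.2 hδ))).exists
  set A := {ω | (n : ℝ) < ‖g ω‖} with hA
  have hgb : MemLp (Aᶜ.indicator g) p μ := by
    refine .of_bound (hg.aestronglyMeasurable.indicator (hm n).compl) n (.of_forall fun ω => ?_)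
    by_cases hω : ω ∈ A
    · simp [hω]
    · simpa [hω] using le_of_not_gt hω
  obtain ⟨s, hsε, hsp⟩ := hgb.exists_simpleFunc_eLpNorm_sub_lt hp
    (ENNReal.ofReal_pos.2 (half_pos hε)).ne'
  have hs : PDunfordIntegrable p s μ := fun x' => x'.comp_memLp' hsp
  refine ⟨s, hs, ContinuousLinearMap.opNorm_le_of_unit_norm hε.le fun x' hx' => ?_⟩
  have hsub : (dunfordS hf - dunfordS hs) x' =
      ((hf x').sub (hs x')).toLp _ := ((hf x').toLp_sub (hs x')).symm
  rw [hsub, Lp.norm_toLp]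
  refine ENNReal.toReal_le_of_le_ofReal hε.le ?_
  -- Uniform integrability controls the part on `A`, since `μ A ≤ δ`; off `A`, the `X`-valued `L^p`
  -- distance to `s` bounds all `x'` at once.
  have hae : (fun ω => x' (f ω)) - (fun ω => x' (s ω)) =ᵐ[μ]
      (A.indicator fun ω => x' (f ω)) + fun ω => x' ((Aᶜ.indicator g - s) ω) := by
    filter_upwards [hfg] with ω hω
    by_cases hωA : ω ∈ A <;> simp [hωA, hω]; ring
  have h2 : eLpNorm (fun ω => x' ((Aᶜ.indicator g - s) ω)) p μ ≤ ENNReal.ofReal (ε / 2) := by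
    refine le_trans (eLpNorm_mono fun ω => ?_) hsε.le
    simpa [hx'] using x'.le_opNorm ((Aᶜ.indicator g - s) ω)
  calc _ = eLpNorm _ p μ := eLpNorm_congr_ae hae
    _ ≤ _ := eLpNorm_add_le ((hf x').1.indicator (hm n))
      (x'.comp_memLp' (hgb.sub hsp)).1 hp1
    _ ≤ ENNReal.ofReal (ε / 2) + ENNReal.ofReal (ε / 2) :=
      add_le_add (hUδ ⟨x', hx'.le⟩ A (hm n) hn) h2
    _ = ENNReal.ofReal ε := by
      rw [← ENNReal.ofReal_add (half_pos hε).le (half_pos hε).le, add_halves]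

theorem isCompactOperator_dunfordT_of_unifIntegrable [IsFiniteMeasure μ] [Fact (1 ≤ p)]
    [Fact (1 ≤ p')] [ENNReal.HolderConjugate p p'] (hp : p ≠ ∞)
    {f : Ω → X} (hfm : AEStronglyMeasurable f μ) (hf : PDunfordIntegrable p f μ)
    (hU : UnifIntegrable (fun (x' : {x' : StrongDual ℝ X // ‖x'‖ ≤ 1}) ω => x'.1 (f ω)) p μ) :
    IsCompactOperator (dunfordT (p' := p') hf) := by
  -- `Φ` takes adjoints of arbitrary operators, so the closure argument can run in operator norm; `Φ
  -- (dunfordS hf)` is `dunfordT hf` by definition.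
  let Φ : (StrongDual ℝ X →L[ℝ] Lp ℝ p μ) → (Lp ℝ p' μ →L[ℝ] StrongDual ℝ (StrongDual ℝ X)) :=
    fun S => (ContinuousLinearMap.compL ℝ (StrongDual ℝ X) (Lp ℝ p μ) ℝ).flip S ∘L
      (ContinuousLinearMap.mul ℝ ℝ).lpPairing μ p' p
  have hΦ : Continuous Φ := by fun_prop
  have hcl : IsClosed {S | IsCompactOperator (Φ S)} :=
    isClosed_setOfPred_isCompactOperator.preimage hΦ
  refine hcl.closure_subset (Metric.mem_closure_iff.2 fun ε hε => ?_ :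
    dunfordS hf ∈ closure {S | IsCompactOperator (Φ S)})
  obtain ⟨s, hs, hle⟩ := exists_simpleFunc_norm_dunfordS_sub_le hp hfm hf hU (half_pos hε)
  exact ⟨dunfordS hs, isCompactOperator_dunfordT_simpleFunc s hs,
    by rw [dist_eq_norm]; linarith⟩

/-! ### Compactness implies uniform integrability -/

theorem norm_dunfordT_apply_le_of_support [Fact (1 ≤ p)] [Fact (1 ≤ p')]
    [ENNReal.HolderConjugate p p'] {f : Ω → X} (hf : PDunfordIntegrable p f μ)
    {A : Set Ω} (hA : MeasurableSet A) {g : Lp ℝ p' μ} (hg : ∀ᵐ ω ∂μ, ω ∉ A → g ω = 0)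
    (x' : StrongDual ℝ X) :
    ‖dunfordT hf g x'‖ ≤ ‖(ContinuousLinearMap.mul ℝ ℝ).lpPairing μ p' p‖ * ‖g‖ *
      (eLpNorm (A.indicator fun ω => x' (f ω)) p μ).toReal := by
  have hm : MemLp (A.indicator fun ω => x' (f ω)) p μ := (hf x').indicator hA
  have h1 : dunfordT hf g x' =
      (ContinuousLinearMap.mul ℝ ℝ).lpPairing μ p' p g (hm.toLp _) := by
    rw [dunfordT_apply, ContinuousLinearMap.lpPairing_eq_integral]
    refine integral_congr_ae ?_
    filter_upwards [hg, hm.coeFn_toLp] with ω h2 h3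
    by_cases hω : ω ∈ A <;> simp [h3, hω, h2]
  rw [h1, ← Lp.norm_toLp _ hm]
  exact ContinuousLinearMap.le_opNorm₂ _ _ _

/-- Reverse Hölder is applied to `⟨f, x'⟩` cut off to `A`; its vanishing clause keeps the norming
function supported in `A`. -/
theorem exists_le_norm_dunfordT_of_support [Fact (1 ≤ p)] [Fact (1 ≤ p')]
    [ENNReal.HolderConjugate p p'] (hp : p ≠ ∞) {f : Ω → X} (hf : PDunfordIntegrable p f μ)
    {A : Set Ω} (hA : MeasurableSet A) {x' : StrongDual ℝ X} (hx' : ‖x'‖ ≤ 1) {ε : ℝ}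
    (hε : ENNReal.ofReal ε ≤ eLpNorm (A.indicator fun ω => x' (f ω)) p μ) :
    ∃ g : Lp ℝ p' μ, ‖g‖ ≤ 1 ∧ (∀ᵐ ω ∂μ, ω ∉ A → g ω = 0) ∧ ε ≤ ‖dunfordT hf g‖ := by
  obtain ⟨g, hg, hg1, hg0, hgi⟩ := ((hf x').indicator hA).exists_norming_dual (p' := p') hp
  have hgA : ∀ ω, ω ∉ A → g ω = 0 := fun ω hω => hg0 ω (by simp [hω])
  refine ⟨hg.toLp g, ?_, ?_, ?_⟩
  · rw [Lp.norm_toLp]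
    exact ENNReal.toReal_le_of_le_ofReal zero_le_one (by simpa using hg1)
  · filter_upwards [hg.coeFn_toLp] with ω h1 h2
    rw [h1, hgA ω h2]
  · have h1 : dunfordT hf (hg.toLp g) x' =
        (eLpNorm (A.indicator fun ω => x' (f ω)) p μ).toReal := by
      rw [dunfordT_apply, ← hgi]
      refine integral_congr_ae ?_
      filter_upwards [hg.coeFn_toLp] with ω h2
      by_cases hω : ω ∈ A <;> simp [h2, hω, hgA]
    calc ε ≤ (eLpNorm (A.indicator fun ω => x' (f ω)) p μ).toReal :=
          (ENNReal.ofReal_le_iff_le_toReal ((hf x').indicator hA).2.ne).1 hε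
      _ ≤ ‖dunfordT hf (hg.toLp g) x'‖ := by rw [h1]; exact le_abs_self _
      _ ≤ ‖dunfordT hf (hg.toLp g)‖ := ContinuousLinearMap.unit_le_opNorm _ _ hx'

theorem tendsto_strongDual_apply {E ι : Type*} [NormedAddCommGroup E] [NormedSpace ℝ E]
    {l : Filter ι} {u : ι → StrongDual ℝ E} {ξ : StrongDual ℝ E} (hu : Tendsto u l (𝓝 ξ)) (x : E) :
    Tendsto (fun n => u n x) l (𝓝 (ξ x)) :=
  ((ContinuousLinearMap.apply ℝ ℝ x).continuous.tendsto ξ).comp hu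

theorem unifIntegrable_of_isCompactOperator_dunfordT [Fact (1 ≤ p)]
    [Fact (1 ≤ p')] [ENNReal.HolderConjugate p p'] (hp : p ≠ ∞)
    {f : Ω → X} (hf : PDunfordIntegrable p f μ) (hT : IsCompactOperator (dunfordT (p' := p') hf)) :
    UnifIntegrable (fun (x' : {x' : StrongDual ℝ X // ‖x'‖ ≤ 1}) ω => x'.1 (f ω)) p μ := by
  intro ε hε
  by_contra! hcon
  have hpos : ∀ n : ℕ, (0 : ℝ) < 1 / (n + 1) := fun n => Nat.one_div_pos_of_nat
  choose x A hA hμA hlt using fun n : ℕ => hcon (1 / (n + 1)) (hpos n)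
  choose g hg1 hgA hgε using fun n =>
    exists_le_norm_dunfordT_of_support (p' := p') hp hf (hA n) (x n).2 (hlt n).le
  obtain ⟨K, hK, hTK⟩ := IsCompactOperator.image_closedBall_subset_compact
    (f := (dunfordT (p' := p') hf).toLinearMap) hT 1
  obtain ⟨ξ, -, φ, hφ, hξ⟩ := hK.tendsto_subseq (x := fun n => dunfordT hf (g n)) fun n =>
    hTK ⟨g n, by simpa using hg1 n, rfl⟩
  -- A single `L^p` function has absolutely continuous norm; with Hölder on `A n`, this gives the
  -- weak* limit `0`.
  have hind : ∀ x' : StrongDual ℝ X, Tendsto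
      (fun n => (eLpNorm ((A n).indicator fun ω => x' (f ω)) p μ).toReal) atTop (𝓝 0) := by
    intro x'
    refine Metric.tendsto_atTop.2 fun η hη => ?_
    obtain ⟨δ, hδ, h⟩ := (hf x').eLpNorm_indicator_le Fact.out hp (half_pos hη)
    obtain ⟨N, hN⟩ := exists_nat_one_div_lt hδ
    refine ⟨N, fun n hn => ?_⟩
    have h1 := h (A n) (hA n) ((hμA n).trans (ENNReal.ofReal_le_ofReal
      ((Nat.one_div_le_one_div hn).trans hN.le)))
    have h2 := ENNReal.toReal_le_of_le_ofReal (half_pos hη).le h1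
    rw [Real.dist_eq, sub_zero, abs_of_nonneg ENNReal.toReal_nonneg]
    linarith
  have hξ0 : ξ = 0 := by
    ext x'
    have h1 : Tendsto (fun n => dunfordT hf (g (φ n)) x') atTop (𝓝 (ξ x')) :=
      tendsto_strongDual_apply hξ x'
    refine tendsto_nhds_unique h1 (squeeze_zero_norm (fun n => ?_)
      (a := fun n => ‖(ContinuousLinearMap.mul ℝ ℝ).lpPairing μ p' p‖ *
        (eLpNorm ((A (φ n)).indicator fun ω => x' (f ω)) p μ).toReal) ?_)
    · exact (norm_dunfordT_apply_le_of_support hf (hA (φ n)) (hgA (φ n)) x').trans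
        (mul_le_mul_of_nonneg_right (mul_le_of_le_one_right (norm_nonneg _) (hg1 _))
          ENNReal.toReal_nonneg)
    · simpa using ((hind x').comp hφ.tendsto_atTop).const_mul
        ‖(ContinuousLinearMap.mul ℝ ℝ).lpPairing μ p' p‖
  have := le_of_tendsto_of_tendsto' tendsto_const_nhds hξ.norm fun n => hgε (φ n)
  rw [hξ0, norm_zero] at this
  linarith

end Dunford

/-- A strongly measurable `p`-Dunford integrable function `f` has a compact Dunford operator
`T_f^p` if and only if `Z_f^p` is uniformly integrable in `L^1(μ)`. Strong measurability (being the
`μ`-a.e. limit of a sequence of simple functions) is `AEStronglyMeasurable f μ`; uniform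
integrability (norm bounded, and `∫_A |h| dμ` is uniformly small for `h` in the set when `μ A` is
small) is Mathlib's `UniformIntegrable` with exponent `1`. -/
theorem corollary3p7 {Ω : Type*} [MeasurableSpace Ω] (μ : Measure Ω) [IsProbabilityMeasure μ]
    [μ.IsComplete] {X : Type*} [NormedAddCommGroup X] [NormedSpace ℝ X] [CompleteSpace X]
    (p p' : ℝ≥0∞) [Fact (1 ≤ p)] [Fact (1 ≤ p')] [ENNReal.HolderConjugate p p'] (hp : p ≠ ∞)
    (f : Ω → X) (hfm : AEStronglyMeasurable f μ) (hf : PDunfordIntegrable p f μ) :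
    IsCompactOperator (dunfordT (p' := p') hf) ↔
      UniformIntegrable (fun (h : dunfordZ p f) => (h : Ω → ℝ)) 1 μ := by
  rw [uniformIntegrable_dunfordZ_iff hp hf]
  exact ⟨unifIntegrable_of_isCompactOperator_dunfordT hp hf,
    isCompactOperator_dunfordT_of_unifIntegrable hp hfm hf⟩
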